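/- Consider a single-input multiple-output (SIMO) channel between two continuous-aperture arrays (CAPAs). The transmit aperture $\mathcal{A}_{\mathsf t}$ and the receive aperture $\mathcal{A}_{\mathsf r}=[-\frac{L_x}{2},\frac{L_x}{2}]\times[-\frac{L_z}{2},\frac{L_z}{2}]$ are rectangles of areas $\mu(\mathcal{A}_{\mathsf t}),\mu(\mathcal{A}_{\mathsf r})>0$. The spatial response at the receive point $\mathbf r=(r_x,r_z)$ is $\mathsf h(\mathbf r)=\sum_{i=1}^{D_{\mathsf r}}\psi_i(\mathbf r)h_i$, where $D_{\mathsf r}\ge 1$, the functions $\psi_i(\mathbf r)=e^{\mathrm j2\pi(\ell_i r_x/L_x+m_i r_z/L_z)}$ are Fourier modes with pairwise distinct $(\ell_i,m_i)\in\mathbb Z^2$, and the coefficients $h_i\sim\mathcal{CN}(0,\sigma_{\mathsf r,i}^2)$, $\sigma_{\mathsf r,i}^2>0$, are independent circularly symmetric complex Gaussian random variables. A Gaussian symbol $s$, carried by a waveform with value $w\neq0$ at the origin, is received as $\mathsf y(\mathbf r)=s\,w\,\mu(\mathcal{A}_{\mathsf t})\,\mathsf h(\mathbf r)+\mathsf z(\mathbf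 r)$ with white Gaussian noise $\mathsf z$ of strength $\sigma^2>0$; the receiver forms $y_i=\int_{\mathcal{A}_{\mathsf r}}\psi_i^*(\mathbf r)\mathsf y(\mathbf r)\,d\mathbf r$ and applies maximal-ratio combining to $(y_1,\dots,y_{D_{\mathsf r}})$. Let $\bar\gamma=\mu(\mathcal{A}_{\mathsf t})|w|^2\mathbb E\{|s|^2\}/\sigma^2$ be the transmit signal-to-noise ratio and let $\mathsf R=\log_2(1+\mathsf{SNR})$ be the achieved data rate, where $\mathsf{SNR}$ is the signal-to-noise ratio after combining, so that $\mathsf R=\log_2\bigl(1+\bar\gamma\,\mu(\mathcal{A}_{\mathsf t})\mu(\mathcal{A}_{\mathsf r})\sum_{i}|h_i|^2\bigr)$. Put $\sigma_{\min}^2=\min_i\sigma_{\mathsf r,i}^2$, $\psi_0=1$ and $\psi_q=\frac1q\sum_{k=1}^q\Bigl[\sum_{j=1}^{D_{\mathsf r}}\bigl(1-\sigma_{\min}^2/\sigma_{\mathsf r,j}^2\bigr)^k\Bigr]\psi_{q-k}$ for $q\ge1$, and let $\psi(x)=\frac{d}{dx}\ln\Gamma(x)$ be the digamma function. Then the following hold.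 1. For every fixed target rate $R>0$, the outage probability satisfies, as $\bar\gamma\to\infty$, $$\Pr(\mathsf R<R)\sim\left(\frac{2^R-1}{\mu(\mathcal{A}_{\mathsf t})\mu(\mathcal{A}_{\mathsf r})}\right)^{D_{\mathsf r}}\frac{1}{D_{\mathsf r}!\prod_{i=1}^{D_{\mathsf r}}\sigma_{\mathsf r,i}^2}\,\bar\gamma^{-D_{\mathsf r}},$$ that is, the ratio of the two sides tends to $1$. 2. The average data rate $\mathbb E\{\mathsf R\}$ is finite for every $\bar\gamma>0$, the series below converges absolutely, and as $\bar\gamma\to\infty$ $$\mathbb E\{\mathsf R\}=\log_2\bar\gamma+\log_2(\mu(\mathcal{A}_{\mathsf t})\mu(\mathcal{A}_{\mathsf r}))+\frac{\sigma_{\min}^{2D_{\mathsf r}}}{\prod_{i=1}^{D_{\mathsf r}}\sigma_{\mathsf r,i}^2}\sum_{q=0}^\infty\frac{\psi_q\,(\psi(D_{\mathsf r}+q)+\ln\sigma_{\min}^2)}{\ln 2}+o(1).$$ 3. For every multiplexing gain $r\in(0,1)$, the diversity order is $$d(r):=\lim_{\bar\gamma\to\infty}-\frac{\log\Pr(\mathsf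 R<r\log_2(1+\bar\gamma))}{\log\bar\gamma}=D_{\mathsf r}(1-r).$$ 4. For every $r\in(0,1)$, the array gain $a(r)>0$, defined by $a(r)^{-d(r)}=\lim_{\bar\gamma\to\infty}\bar\gamma^{d(r)}\Pr(\mathsf R<r\log_2(1+\bar\gamma))$ (the limit exists), is $$a(r)=\left((\mu(\mathcal{A}_{\mathsf t})\mu(\mathcal{A}_{\mathsf r}))^{D_{\mathsf r}}\,D_{\mathsf r}!\prod_{i=1}^{D_{\mathsf r}}\sigma_{\mathsf r,i}^2\right)^{\frac{1}{D_{\mathsf r}(1-r)}}.$$ -/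

import Mathlib

open MeasureTheory ProbabilityTheory Filter Topology Asymptotics
open scoped ComplexConjugate NNReal

noncomputable section

namespace CAPA

/-- The circularly symmetric complex Gaussian law with mean zero and variance `v`: real and
imaginary parts are independent real Gaussians of mean zero and variance `v / 2` each. -/
def circularGaussian (v : ℝ≥0) : Measure ℂ :=
  ((gaussianReal 0 (v / 2)).prod (gaussianReal 0 (v / 2))).map (fun p : ℝ × ℝ => (⟨p.1, p.2⟩ : ℂ))

/-- The parameters of a SIMO channel between two continuous-aperture arrays with `D` receive
angular modes. -/
structure SIMOChannel (D : ℕ) where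
  /-- side lengths of the transmit aperture -/
  Ltx : ℝ
  Ltz : ℝ
  /-- side lengths of the receive aperture -/
  Lrx : ℝ
  Lrz : ℝ
  Ltx_pos : 0 < Ltx
  Ltz_pos : 0 < Ltz
  Lrx_pos : 0 < Lrx
  Lrz_pos : 0 < Lrz
  /-- the integer angular frequencies of the receive modes, pairwise distinct; for a linear array
  the second component is `0`, for a planar array they run through a set of lattice points. -/
  freq : Fin D → ℤ × ℤ
  freq_injective : Function.Injective freq
  /-- the variances of the angular-domain coefficients -/
  sigmaSq : Fin D → ℝ
  sigmaSq_pos : ∀ i, 0 < sigmaSq i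
  /-- the strength of the white noise field at the receiver -/
  noise : ℝ
  noise_pos : 0 < noise
  /-- the value at the origin of the waveform that carries the symbol -/
  waveform : ℂ
  waveform_ne_zero : waveform ≠ 0

namespace SIMOChannel

variable {D : ℕ} (C : SIMOChannel D)

/-- The transmit aperture, in the coordinates along the `x`- and `z`-axes. -/
def txAperture : Set (ℝ × ℝ) :=
  Set.Icc (-(C.Ltx / 2)) (C.Ltx / 2) ×ˢ Set.Icc (-(C.Ltz / 2)) (C.Ltz / 2)

/-- The receive aperture, in the coordinates along the `x`- and `z`-axes. -/
def rxAperture : Set (ℝ × ℝ) :=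
  Set.Icc (-(C.Lrx / 2)) (C.Lrx / 2) ×ˢ Set.Icc (-(C.Lrz / 2)) (C.Lrz / 2)

/-- The area of the transmit aperture. -/
def txArea : ℝ := volume.real C.txAperture

/-- The area of the receive aperture. -/
def rxArea : ℝ := volume.real C.rxAperture

/-- The Fourier modes `exp (2πj (ℓ_x r_x / L_x + ℓ_z r_z / L_z))` on the receive aperture. -/
def mode (i : Fin D) (r : ℝ × ℝ) : ℂ :=
  Complex.exp (2 * Real.pi * Complex.I *
    ((C.freq i).1 * r.1 / C.Lrx + (C.freq i).2 * r.2 / C.Lrz))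

/-- The spatial response at the receive point `r`, for the angular-domain coefficients `h`. -/
def response (h : Fin D → ℂ) (r : ℝ × ℝ) : ℂ := ∑ i, C.mode i r * h i

/-- The noise-free received field for the unit symbol; the transmit aperture is small enough for
the response and the waveform to be constant on it. -/
def receivedField (h : Fin D → ℂ) (r : ℝ × ℝ) : ℂ := C.waveform * C.txArea * C.response h r

/-- The noise-free output of the `i`-th equalizer for the unit symbol, that is, the `i`-th entry of
the effective channel vector. -/
def effective (h : Fin D → ℂ) (i : Fin D) : ℂ :=
  ∫ r in C.rxAperture, conj (C.mode i r) * C.receivedField h r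

/-- The covariance of the white noise at the outputs of the equalizers `i` and `j`. -/
def noiseCov (i j : Fin D) : ℂ := C.noise * ∫ r in C.rxAperture, conj (C.mode i r) * C.mode j r

/-- The signal-to-noise ratio for the symbol power `p` at the output of the linear combiner `v`
applied to the equalizer outputs. -/
def combinedSNR (v : Fin D → ℂ) (p : ℝ) (h : Fin D → ℂ) : ℝ :=
  p * ‖∑ i, conj (v i) * C.effective h i‖ ^ 2 / (∑ i, ∑ j, conj (v i) * C.noiseCov i j * v j).re

/-- The transmit signal-to-noise ratio for the symbol power `p`. -/
def transmitSNR (p : ℝ) : ℝ := C.txArea * ‖C.waveform‖ ^ 2 * p / C.noise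

/-- The symbol power for which the transmit signal-to-noise ratio is `γ`. -/
def symbolPower (γ : ℝ) : ℝ := γ * C.noise / (C.txArea * ‖C.waveform‖ ^ 2)

/-- The data rate achieved at the transmit signal-to-noise ratio `γ` by a Gaussian symbol and
maximal-ratio combining (the combiner is the effective channel vector). -/
def rate (γ : ℝ) (h : Fin D → ℂ) : ℝ :=
  Real.logb 2 (1 + C.combinedSNR (C.effective h) (C.symbolPower γ) h)

variable {Ω : Type*} [MeasurableSpace Ω]

/-- Rayleigh fading: the angular-domain coefficients are independent, the `i`-th one being
circularly symmetric complex Gaussian with mean zero and variance `sigmaSq i`. -/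
def IsRayleigh (P : Measure Ω) (h : Fin D → Ω → ℂ) : Prop :=
  iIndepFun h P ∧ ∀ i, HasLaw (h i) (circularGaussian (C.sigmaSq i).toNNReal) P

/-- The outage probability for the target rate `R`. -/
def outage (P : Measure Ω) (h : Fin D → Ω → ℂ) (γ R : ℝ) : ℝ :=
  P.real {ω | C.rate γ (fun i => h i ω) < R}

/-- The average data rate. -/
def averageRate (P : Measure Ω) (h : Fin D → Ω → ℂ) (γ : ℝ) : ℝ :=
  ∫ ω, C.rate γ (fun i => h i ω) ∂P

/-- The outage probability for the target rate `r log₂ (1 + γ)`. -/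
def outageAt (P : Measure Ω) (h : Fin D → Ω → ℂ) (r γ : ℝ) : ℝ :=
  C.outage P h γ (r * Real.logb 2 (1 + γ))

/-- `d` is the diversity order at the multiplexing gain `r`. -/
def IsDiversityOrder (P : Measure Ω) (h : Fin D → Ω → ℂ) (r d : ℝ) : Prop :=
  Tendsto (fun γ => -(Real.log (C.outageAt P h r γ) / Real.log γ)) atTop (𝓝 d)

/-- `a` is the array gain at the multiplexing gain `r`, for the diversity order `d`. -/
def IsArrayGain (P : Measure Ω) (h : Fin D → Ω → ℂ) (r d a : ℝ) : Prop :=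
  0 < a ∧ Tendsto (fun γ => C.outageAt P h r γ / γ ^ (-d)) atTop (𝓝 (a ^ (-d)))

/-- The smallest variance. -/
def sigmaSqMin : ℝ := ⨅ i, C.sigmaSq i

/-- The coefficients `ψ_q`: `ψ_0 = 1` and
`ψ_q = (1/q) ∑_{k=1}^q (∑_j (1 - σ²_min / σ²_j)^k) ψ_{q-k}`. -/
def psiCoeff : ℕ → ℝ
  | 0 => 1
  | q + 1 => (∑ k : Fin (q + 1),
      (∑ j, (1 - C.sigmaSqMin / C.sigmaSq j) ^ ((k : ℕ) + 1)) * psiCoeff (q - k)) / (q + 1)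
termination_by q => q

/-- The `q`-th term of the digamma series. -/
def digammaTerm (q : ℕ) : ℝ :=
  C.psiCoeff q * ((Complex.digamma ((D + q : ℕ) : ℂ)).re + Real.log C.sigmaSqMin) / Real.log 2

end SIMOChannel

end CAPA

end

/-! The Fourier modes are orthogonal on the receive aperture with common norm squared `rxArea`, so
the equalizer outputs are scaled copies of the `h i` with white noise. Maximal-ratio combining then
gives SNR `γ * (txArea * rxArea) * S` with `S = ∑ i, ‖h i‖ ^ 2` (`combinedSNR_effective`), and
everything reduces to the law of `S`.

Each `‖h i‖ ^ 2` is exponential, so `S` has characteristic function `∏ i, (1 - i t σ_i²)⁻¹`. Put `w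
= 1 - i t σ²_min`. Each factor becomes `(σ²_min / σ_i²) w⁻¹ (1 - b_i w⁻¹)⁻¹` with `b_i = 1 - σ²_min
/ σ_i² ∈ [0, 1)`. Expanding the product in powers of `w⁻¹` produces the coefficients `ψ_q`, and `w⁻¹
^ (D + q)` is the characteristic function of a gamma law of shape `D + q`. Hence `S` is a mixture of
gamma laws with nonnegative weights proportional to `ψ_q` (`map_gain`).

Near zero only the component `q = 0` contributes to order `x ^ D` (`tendsto_gainLaw_Iio_div_pow`),
which gives the outage asymptotics, the diversity order and the array gain. Integrating the
logarithm against the mixture gives the digamma series (`hasSum_digammaTerm`), and the error in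
replacing `1 + γ A S` by `γ A S`, where `A = txArea * rxArea`, vanishes by dominated convergence
(`tendsto_averageRate_sub`). -/

noncomputable section

namespace CAPA

/-! ### Generating function of complete homogeneous symmetric polynomials. -/

section GeneratingFunction

open PowerSeries Finset

variable {ι : Type*}

/-- The product of the geometric series `∑ n, (b j) ^ n * X ^ n` over `j ∈ T`; its coefficients are
the complete homogeneous symmetric polynomials in the `b j`. -/
def geomProd (b : ι → ℝ) (T : Finset ι) : PowerSeries ℝ := ∏ j ∈ T, PowerSeries.mk fun n => b j ^ n

lemma derivative_mk_pow (x : ℝ) :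
    derivative ℝ (PowerSeries.mk fun n => x ^ n) = (PowerSeries.mk fun n => x ^ n) * PowerSeries.mk fun n => x ^ (n + 1) := by
  ext q
  rw [coeff_derivative, coeff_mul, coeff_mk]
  simp only [coeff_mk]
  rw [Finset.sum_congr rfl (g := fun _ => x ^ (q + 1))]
  · simp [mul_comm]
  · intro p hp
    rw [← pow_add, ← mem_antidiagonal.1 hp, add_assoc]

/-- The logarithmic derivative of a product of geometric series is the generating series of the
power sums. Comparing coefficients yields Newton's recursion, the one that defines `psiCoeff`. -/
lemma derivative_geomProd (b : ι → ℝ) (T : Finset ι) :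
    derivative ℝ (geomProd b T) = geomProd b T * PowerSeries.mk fun n => ∑ j ∈ T, b j ^ (n + 1) := by
  classical
  induction T using Finset.induction_on with
  | empty =>
    have : (PowerSeries.mk fun _ => 0 : PowerSeries ℝ) = 0 := by ext; simp
    simp [geomProd, this]
  | insert a s ha ih =>
    have h1 : (PowerSeries.mk fun n => ∑ j ∈ insert a s, b j ^ (n + 1) : PowerSeries ℝ) =
        (PowerSeries.mk fun n => b a ^ (n + 1)) + PowerSeries.mk fun n => ∑ j ∈ s, b j ^ (n + 1) := by
      ext n; simp [Finset.sum_insert ha]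
    have h2 : geomProd b (insert a s) = (PowerSeries.mk fun n => b a ^ n) * geomProd b s :=
      Finset.prod_insert ha
    rw [h1, h2, Derivation.leibniz, ih, derivative_mk_pow, smul_eq_mul, smul_eq_mul]
    ring

lemma coeff_geomProd_succ (b : ι → ℝ) (T : Finset ι) (q : ℕ) :
    coeff (q + 1) (geomProd b T) =
      (∑ k : Fin (q + 1), (∑ j ∈ T, b j ^ ((k : ℕ) + 1)) * coeff (q - k) (geomProd b T)) /
        (q + 1) := by
  have h := congrArg (coeff q) (derivative_geomProd b T)
  rw [coeff_derivative, mul_comm (geomProd b T), coeff_mul,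
    Finset.Nat.sum_antidiagonal_eq_sum_range_succ_mk] at h
  rw [eq_div_iff (by positivity), h, Finset.sum_range]
  simp

lemma coeff_geomProd_zero (b : ι → ℝ) (T : Finset ι) : coeff 0 (geomProd b T) = 1 := by
  simp [geomProd, map_prod]

/-- Cauchy products of absolutely convergent geometric series, by induction on `T`. As every `b j`
is strictly below 1, the closed unit disc is allowed; the point `u = 1` gives summability of the
coefficients. -/
lemma geomProd_hasSum {b : ι → ℝ} {T : Finset ι} (h0 : ∀ j ∈ T, 0 ≤ b j) (h1 : ∀ j ∈ T, b j < 1) :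
    (∀ q, 0 ≤ coeff q (geomProd b T)) ∧ ∀ u : ℂ, ‖u‖ ≤ 1 →
      (Summable fun q => ‖((coeff q (geomProd b T) : ℝ) : ℂ) * u ^ q‖) ∧
      ∑' q, ((coeff q (geomProd b T) : ℝ) : ℂ) * u ^ q = ∏ j ∈ T, (1 - b j * u)⁻¹ := by
  classical
  induction T using Finset.induction_on with
  | empty =>
    refine ⟨fun q => ?_, fun u _ => ⟨?_, ?_⟩⟩
    · simp only [geomProd, Finset.prod_empty, coeff_one]; split_ifs <;> norm_num
    · refine summable_of_ne_finset_zero (s := {0}) fun q hq => ?_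
      have : q ≠ 0 := by simpa using hq
      simp [geomProd, coeff_one, this]
    · rw [tsum_eq_single 0]
      · simp [geomProd]
      · intro q hq
        simp [geomProd, coeff_one, hq]
  | insert a s ha ih =>
    obtain ⟨hn, hs⟩ := ih (fun j hj => h0 j (mem_insert_of_mem hj))
      (fun j hj => h1 j (mem_insert_of_mem hj))
    have ha0 := h0 a (mem_insert_self a s)
    have ha1 := h1 a (mem_insert_self a s)
    have hc : ∀ q, coeff q (geomProd b (insert a s)) =
        ∑ p ∈ antidiagonal q, b a ^ p.1 * coeff p.2 (geomProd b s) := fun q => by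
      rw [geomProd, Finset.prod_insert ha, coeff_mul]; simp [geomProd]
    refine ⟨fun q => ?_, fun u hu => ?_⟩
    · rw [hc]
      exact Finset.sum_nonneg fun p _ => mul_nonneg (pow_nonneg ha0 _) (hn _)
    · obtain ⟨hs1, hs2⟩ := hs u hu
      have hlt : ‖(b a : ℂ) * u‖ < 1 := by
        rw [norm_mul, Complex.norm_of_nonneg ha0]
        nlinarith [norm_nonneg u]
      have hg : Summable fun q => ‖((b a : ℂ) * u) ^ q‖ := by
        simpa [norm_pow] using summable_geometric_of_lt_one (norm_nonneg _) hlt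
      have he : ∀ q, ((coeff q (geomProd b (insert a s)) : ℝ) : ℂ) * u ^ q = ∑ p ∈ antidiagonal q,
          ((b a : ℂ) * u) ^ p.1 * (((coeff p.2 (geomProd b s) : ℝ) : ℂ) * u ^ p.2) := fun q => by
        rw [hc]
        push_cast
        rw [Finset.sum_mul]
        refine Finset.sum_congr rfl fun p hp => ?_
        rw [← mem_antidiagonal.1 hp, pow_add, mul_pow]
        ring
      simp only [he]
      have hsum := summable_norm_sum_mul_antidiagonal_of_summable_norm (f := fun n => (b a * u) ^ n)
        (g := fun n => ((coeff n (geomProd b s) : ℝ) : ℂ) * u ^ n) hg hs1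
      refine ⟨hsum, ?_⟩
      rw [← tsum_mul_tsum_eq_tsum_sum_antidiagonal_of_summable_norm (f := fun n => (b a * u) ^ n)
        (g := fun n => ((coeff n (geomProd b s) : ℝ) : ℂ) * u ^ n) hg hs1, hs2,
        tsum_geometric_of_norm_lt_one hlt, Finset.prod_insert ha]

end GeneratingFunction

/-! ### The coefficients `psiCoeff` as generating-function coefficients. -/

namespace SIMOChannel

variable {D : ℕ} (C : SIMOChannel D)

lemma psiCoeff_eq_coeff (q : ℕ) : C.psiCoeff q =
    PowerSeries.coeff q (geomProd (fun j => 1 - C.sigmaSqMin / C.sigmaSq j) Finset.univ) := by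
  induction q using Nat.strong_induction_on with
  | _ q ih =>
    cases q with
    | zero => rw [psiCoeff, coeff_geomProd_zero]
    | succ q =>
      rw [psiCoeff, coeff_geomProd_succ]
      congr 1
      refine Finset.sum_congr rfl fun k _ => ?_
      rw [ih _ (by omega)]

lemma sigmaSqMin_le (i : Fin D) : C.sigmaSqMin ≤ C.sigmaSq i :=
  ciInf_le (Set.finite_range _).bddBelow i

lemma sigmaSqMin_pos (hD : 0 < D) : 0 < C.sigmaSqMin := by
  have : Nonempty (Fin D) := ⟨⟨0, hD⟩⟩
  obtain ⟨i, hi⟩ := exists_eq_ciInf_of_finite (f := C.sigmaSq)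
  rw [sigmaSqMin, ← hi]
  exact C.sigmaSq_pos i

lemma psiCoeff_hasSum (hD : 0 < D) :
    (∀ q, 0 ≤ C.psiCoeff q) ∧ ∀ u : ℂ, ‖u‖ ≤ 1 →
      HasSum (fun q => (C.psiCoeff q : ℂ) * u ^ q)
        (∏ j, (1 - (1 - C.sigmaSqMin / C.sigmaSq j : ℝ) * u)⁻¹) := by
  have hm := C.sigmaSqMin_pos hD
  obtain ⟨h1, h2⟩ := geomProd_hasSum (b := fun j => 1 - C.sigmaSqMin / C.sigmaSq j)
    (T := Finset.univ)
    (fun j _ => sub_nonneg.2 ((div_le_one (C.sigmaSq_pos j)).2 (C.sigmaSqMin_le j)))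
    (fun j _ => sub_lt_self _ (div_pos hm (C.sigmaSq_pos j)))
  simp only [← psiCoeff_eq_coeff] at h1 h2
  refine ⟨h1, fun u hu => ?_⟩
  obtain ⟨h3, h4⟩ := h2 u hu
  rw [← h4]
  exact h3.of_norm.hasSum

lemma summable_psiCoeff (hD : 0 < D) : Summable C.psiCoeff := by
  have h := ((C.psiCoeff_hasSum hD).2 1 (by simp)).summable
  simp only [one_pow, mul_one] at h
  exact_mod_cast h

end SIMOChannel

/-! ### Gamma laws of integer shape: characteristic function, logarithmic moment, mass near zero. -/

section Gamma

open Set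

/-- The density of the gamma law of shape `k` and rate `r` on the positive half-line. -/
def gammaDensity (k : ℕ) (r x : ℝ) : ℝ :=
  r ^ k / (k - 1).factorial * x ^ (k - 1) * Real.exp (-(r * x))

lemma continuous_gammaDensity (k : ℕ) (r : ℝ) : Continuous (gammaDensity k r) := by
  unfold gammaDensity; fun_prop

lemma gammaDensity_nonneg {k : ℕ} {r x : ℝ} (hr : 0 < r) (hx : 0 ≤ x) : 0 ≤ gammaDensity k r x := by
  unfold gammaDensity; positivity

lemma gammaMeasure_eq_withDensity {k : ℕ} (hk : 0 < k) (r : ℝ) :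
    gammaMeasure k r =
      (volume.restrict (Ioi 0)).withDensity fun x => ENNReal.ofReal (gammaDensity k r x) := by
  rw [gammaMeasure, ← withDensity_indicator measurableSet_Ioi]
  refine withDensity_congr_ae ?_
  -- The two densities can differ at 0, for instance when `k = 1`; a null set does not matter.
  have h0 : ∀ᵐ x : ℝ, x ≠ 0 := by simp [ae_iff]
  filter_upwards [h0] with x hx
  obtain ⟨m, rfl⟩ : ∃ m, k = m + 1 := ⟨k - 1, by omega⟩
  rcases lt_or_gt_of_ne hx with hx | hx
  · rw [gammaPDF_of_neg hx, indicator_of_notMem (by simp [hx.le])]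
  · rw [gammaPDF_of_nonneg hx.le, indicator_of_mem (by simpa using hx), gammaDensity,
      Real.rpow_natCast]
    congr 3
    · push_cast; rw [Real.Gamma_nat_eq_factorial]
    · rw [Nat.cast_add_one, add_sub_cancel_right, Real.rpow_natCast, Nat.add_sub_cancel]

variable {E : Type*} [NormedAddCommGroup E] [NormedSpace ℝ E]

lemma integral_gammaMeasure {k : ℕ} (hk : 0 < k) {r : ℝ} (hr : 0 < r) (f : ℝ → E) :
    ∫ x, f x ∂gammaMeasure k r = ∫ x in Ioi 0, gammaDensity k r x • f x := by
  rw [gammaMeasure_eq_withDensity hk, integral_withDensity_eq_integral_toReal_smul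
    (continuous_gammaDensity k r).measurable.ennreal_ofReal (by simp)]
  refine setIntegral_congr_fun measurableSet_Ioi fun x hx => ?_
  rw [ENNReal.toReal_ofReal (gammaDensity_nonneg hr (le_of_lt hx))]

lemma integrable_gammaMeasure_iff {k : ℕ} (hk : 0 < k) {r : ℝ} (hr : 0 < r) (f : ℝ → E) :
    Integrable f (gammaMeasure k r) ↔
      IntegrableOn (fun x => gammaDensity k r x • f x) (Ioi 0) := by
  rw [gammaMeasure_eq_withDensity hk, integrable_withDensity_iff_integrable_smul'
    (continuous_gammaDensity k r).measurable.ennreal_ofReal (by simp)]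
  refine integrableOn_congr_fun (fun x hx => ?_) measurableSet_Ioi
  rw [ENNReal.toReal_ofReal (gammaDensity_nonneg hr (le_of_lt hx))]

lemma gammaMeasure_ae_pos {k : ℕ} (hk : 0 < k) (r : ℝ) : ∀ᵐ x ∂gammaMeasure k r, 0 < x := by
  rw [gammaMeasure_eq_withDensity hk]
  exact (withDensity_absolutelyContinuous _ _).ae_le (ae_restrict_mem measurableSet_Ioi)

lemma integrableOn_pow_mul_cexp_neg (n : ℕ) {b : ℂ} (hb : 0 < b.re) :
    IntegrableOn (fun x : ℝ => (x : ℂ) ^ n * Complex.exp (-(b * x))) (Ioi 0) := by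
  have h := integrableOn_rpow_mul_exp_neg_mul_rpow (s := n) (p := 1) (b := b.re) (by
    have : (0 : ℝ) ≤ n := Nat.cast_nonneg n
    linarith) one_pos hb
  refine Integrable.mono' h (Continuous.aestronglyMeasurable (by fun_prop)) ?_
  refine (ae_restrict_iff' measurableSet_Ioi).2 (ae_of_all _ fun x hx => le_of_eq ?_)
  rw [norm_mul, norm_pow, Complex.norm_real, Complex.norm_exp, Real.norm_of_nonneg (le_of_lt hx)]
  simp

lemma tendsto_pow_mul_cexp_neg (n : ℕ) {b : ℂ} (hb : 0 < b.re) :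
    Tendsto (fun x : ℝ => (x : ℂ) ^ n * Complex.exp (-(b * x))) atTop (𝓝 0) := by
  rw [tendsto_zero_iff_norm_tendsto_zero]
  refine ((isLittleO_pow_exp_pos_mul_atTop n hb).tendsto_div_nhds_zero).congr' ?_
  filter_upwards [eventually_ge_atTop 0] with x hx
  rw [norm_mul, norm_pow, Complex.norm_real, Complex.norm_exp, Real.norm_of_nonneg hx, div_eq_mul_inv,
    ← Real.exp_neg]
  simp

/-- Integration by parts: the integral of the derivative of `x ^ (n + 1) * exp (-b x)` vanishes. The
complex rate `b` is needed for characteristic functions. -/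
lemma integral_pow_mul_cexp_neg (n : ℕ) {b : ℂ} (hb : 0 < b.re) :
    ∫ x in Ioi (0 : ℝ), (x : ℂ) ^ n * Complex.exp (-(b * x)) = n.factorial / b ^ (n + 1) := by
  have hb0 : b ≠ 0 := fun h => by simp [h] at hb
  have hexp : ∀ x : ℝ, HasDerivAt (fun x : ℝ => Complex.exp (-(b * x)))
      (Complex.exp (-(b * x)) * -b) x := fun x => by
    have h := ((hasDerivAt_id (x : ℂ)).const_mul b).neg.cexp.comp_ofReal
    simpa using h
  induction n with
  | zero =>
    have h := integral_Ioi_of_hasDerivAt_of_tendsto' (a := (0 : ℝ)) (m := (0 : ℂ))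
      (f := fun x : ℝ => Complex.exp (-(b * x)) * (-b)⁻¹)
      (f' := fun x : ℝ => Complex.exp (-(b * x)))
      (fun x _ => by
        refine ((hexp x).mul_const (-b)⁻¹).congr_deriv ?_
        field_simp)
      (by simpa using integrableOn_pow_mul_cexp_neg 0 hb)
      (by simpa using (tendsto_pow_mul_cexp_neg 0 hb).mul_const (-b)⁻¹)
    simp only [pow_zero, one_mul, h]
    simp
  | succ n ih =>
    have h := integral_Ioi_of_hasDerivAt_of_tendsto' (a := (0 : ℝ)) (m := (0 : ℂ))
      (f := fun x : ℝ => (x : ℂ) ^ (n + 1) * Complex.exp (-(b * x)))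
      (f' := fun x : ℝ => (n + 1 : ℂ) * ((x : ℂ) ^ n * Complex.exp (-(b * x))) +
        (-b) * ((x : ℂ) ^ (n + 1) * Complex.exp (-(b * x))))
      (fun x _ => by
        have hp : HasDerivAt (fun x : ℝ => (x : ℂ) ^ (n + 1)) ((n + 1 : ℂ) * x ^ n) x := by
          simpa using (hasDerivAt_pow (n + 1) (x : ℂ)).comp_ofReal
        refine (hp.mul (hexp x)).congr_deriv ?_
        ring)
      (((integrableOn_pow_mul_cexp_neg n hb).const_mul _).add
        ((integrableOn_pow_mul_cexp_neg (n + 1) hb).const_mul _))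
      (tendsto_pow_mul_cexp_neg (n + 1) hb)
    rw [integral_add ((integrableOn_pow_mul_cexp_neg n hb).const_mul _)
      ((integrableOn_pow_mul_cexp_neg (n + 1) hb).const_mul _), integral_const_mul,
      integral_const_mul, ih] at h
    simp only [Complex.ofReal_zero, zero_pow n.succ_ne_zero, zero_mul, sub_zero] at h
    rw [neg_mul, ← sub_eq_add_neg, sub_eq_zero] at h
    rw [← mul_right_inj' hb0, ← h, Nat.factorial_succ]
    push_cast
    field_simp
    ring

lemma charFun_gammaMeasure {k : ℕ} (hk : 0 < k) {r : ℝ} (hr : 0 < r) (t : ℝ) :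
    charFun (gammaMeasure k r) t = ((1 - t * Complex.I / r)⁻¹) ^ k := by
  have hr' : (r : ℂ) ≠ 0 := by exact_mod_cast hr.ne'
  have hre : 0 < ((r : ℂ) - t * Complex.I).re := by simpa using hr
  have hne : (r : ℂ) - t * Complex.I ≠ 0 := fun h => by rw [h] at hre; simp at hre
  have hf : ((k - 1).factorial : ℂ) ≠ 0 := by exact_mod_cast (k - 1).factorial_ne_zero
  rw [charFun_apply_real, integral_gammaMeasure hk hr]
  have h2 : ∀ x ∈ Ioi (0 : ℝ), gammaDensity k r x • Complex.exp (t * x * Complex.I) =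
      ((r : ℂ) ^ k / (k - 1).factorial) * ((x : ℂ) ^ (k - 1) *
        Complex.exp (-((r - t * Complex.I) * x))) := fun x _ => by
    rw [gammaDensity, Complex.real_smul]
    push_cast
    rw [mul_assoc, ← Complex.exp_add, mul_assoc]
    congr 3
    ring
  rw [setIntegral_congr_fun measurableSet_Ioi h2, integral_const_mul,
    integral_pow_mul_cexp_neg _ hre, Nat.sub_add_cancel hk]
  have h4 : (1 - t * Complex.I / r) = (r - t * Complex.I) / r := by field_simp
  rw [h4, inv_div, div_pow]
  field_simp

lemma integrable_id_gammaMeasure {k : ℕ} (hk : 0 < k) {r : ℝ} (hr : 0 < r) :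
    Integrable (fun x => x) (gammaMeasure k r) := by
  rw [integrable_gammaMeasure_iff hk hr]
  have h := (integrableOn_rpow_mul_exp_neg_mul_rpow (s := k) (p := 1) (b := r) (by
    have : (0 : ℝ) ≤ k := Nat.cast_nonneg k
    linarith) one_pos hr).const_mul (r ^ k / (k - 1).factorial)
  refine IntegrableOn.congr_fun h (fun x hx => ?_) measurableSet_Ioi
  obtain ⟨m, rfl⟩ : ∃ m, k = m + 1 := ⟨k - 1, by omega⟩
  simp only [gammaDensity, Real.rpow_one, smul_eq_mul, Nat.add_sub_cancel, Real.rpow_natCast]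
  rw [pow_succ x m]
  ring_nf

/-- Differentiating Euler's integral at `s = k` brings down a factor `log x`, so the integral equals
`Γ'(k) = Γ(k) ψ(k)`. -/
lemma integral_log_mul_exp_neg {k : ℕ} (hk : 0 < k) :
    IntegrableOn (fun x : ℝ => x ^ (k - 1) * (Real.log x * Real.exp (-x))) (Ioi 0) ∧
    ∫ x in Ioi (0 : ℝ), x ^ (k - 1) * (Real.log x * Real.exp (-x)) =
      (k - 1).factorial * (Complex.digamma k).re := by
  have hk1 : ((k : ℂ) - 1) = ((k - 1 : ℕ) : ℂ) := by rw [Nat.cast_sub hk]; simp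
  have hre : 0 < (k : ℂ).re := by simpa using hk
  -- Only the integrability half is used. The growth exponents `b = 0` at the origin and `a = k + 1`
  -- at infinity enclose `s = k`.
  have hm := mellin_hasDerivAt_of_isBigO_rpow (E := ℂ) (f := fun x : ℝ => (Real.exp (-x) : ℂ))
    (a := k + 1) (b := 0) (s := k) (by
      refine (Continuous.continuousOn ?_).locallyIntegrableOn measurableSet_Ioi
      exact Complex.continuous_ofReal.comp (Real.continuous_exp.comp continuous_neg)) (by
      rw [← isBigO_norm_left]
      simp_rw [Complex.norm_real, isBigO_norm_left]
      simpa only [neg_one_mul] using (isLittleO_exp_neg_mul_rpow_atTop zero_lt_one _).isBigO)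
    (by simp) (by
      simp_rw [neg_zero, Real.rpow_zero]
      refine isBigO_const_of_tendsto (?_ : Tendsto _ _ (𝓝 (1 : ℂ))) one_ne_zero
      rw [(by simp : (1 : ℂ) = Real.exp (-0))]
      exact (Complex.continuous_ofReal.comp
        (Real.continuous_exp.comp continuous_neg)).continuousWithinAt) (by simpa using hk)
  have hfun : ∀ x ∈ Ioi (0 : ℝ), ((x : ℂ) ^ ((k : ℂ) - 1)) •
      (Real.log x • (Real.exp (-x) : ℂ)) =
      ((x ^ (k - 1) * (Real.log x * Real.exp (-x)) : ℝ) : ℂ) := fun x _ => by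
    rw [hk1, Complex.cpow_natCast, smul_eq_mul, Complex.real_smul]
    push_cast
    ring
  have hint : IntegrableOn (fun x : ℝ => x ^ (k - 1) * (Real.log x * Real.exp (-x))) (Ioi 0) := by
    have h := IntegrableOn.congr_fun hm.1 hfun measurableSet_Ioi
    have h' := Integrable.re h
    simpa only [IntegrableOn, RCLike.re_to_complex, Complex.ofReal_re] using h'
  refine ⟨hint, ?_⟩
  have hG : Complex.Gamma k = (k - 1).factorial := by
    obtain ⟨m, rfl⟩ : ∃ m, k = m + 1 := ⟨k - 1, by omega⟩
    push_cast
    rw [Complex.Gamma_nat_eq_factorial]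
  have hd : HasDerivAt Complex.Gamma
      (∫ x in Ioi (0 : ℝ), ((x : ℂ) ^ ((k : ℂ) - 1)) * (Real.log x * Real.exp (-x))) (k : ℂ) := by
    refine (Complex.hasDerivAt_GammaIntegral hre).congr_of_eventuallyEq ?_
    filter_upwards [(isOpen_lt continuous_const Complex.continuous_re).mem_nhds hre] with s hs
    exact Complex.Gamma_eq_integral hs
  have hI : (∫ x in Ioi (0 : ℝ), ((x : ℂ) ^ ((k : ℂ) - 1)) * (Real.log x * Real.exp (-x))) =
      ((∫ x in Ioi (0 : ℝ), x ^ (k - 1) * (Real.log x * Real.exp (-x)) : ℝ) : ℂ) := by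
    rw [← integral_complex_ofReal]
    refine setIntegral_congr_fun measurableSet_Ioi fun x hx => ?_
    rw [← hfun x hx, smul_eq_mul, Complex.real_smul]
  have hf : ((k - 1).factorial : ℝ) ≠ 0 := by exact_mod_cast (k - 1).factorial_ne_zero
  rw [Complex.digamma_def, logDeriv_apply, hd.deriv, hI, hG, ← Complex.ofReal_natCast,
    ← Complex.ofReal_div, Complex.ofReal_re, mul_div_cancel₀ _ hf]

lemma integrable_log_gammaMeasure_and_integral {k : ℕ} (hk : 0 < k) {r : ℝ} (hr : 0 < r) :
    Integrable Real.log (gammaMeasure k r) ∧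
    ∫ x, Real.log x ∂gammaMeasure k r = (Complex.digamma k).re - Real.log r := by
  obtain ⟨h1, h2⟩ := integral_log_mul_exp_neg hk
  have hf : ((k - 1).factorial : ℝ) ≠ 0 := by exact_mod_cast (k - 1).factorial_ne_zero
  have hp : IsProbabilityMeasure (gammaMeasure k r) :=
    isProbabilityMeasure_gammaMeasure (by exact_mod_cast hk) hr
  -- The substitution `y = r x` produces `log (r x)`, so `log r + log x` is integrated and the
  -- constant removed afterwards.
  have heq : ∀ x ∈ Ioi (0 : ℝ), (r / (k - 1).factorial) *
      ((r * x) ^ (k - 1) * (Real.log (r * x) * Real.exp (-(r * x)))) =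
      gammaDensity k r x • (Real.log r + Real.log x) := fun x hx => by
    rw [Real.log_mul hr.ne' (ne_of_gt hx), gammaDensity, mul_pow, smul_eq_mul]
    obtain ⟨m, rfl⟩ : ∃ m, k = m + 1 := ⟨k - 1, by omega⟩
    simp only [Nat.add_sub_cancel]
    ring
  have hint : Integrable (fun x => Real.log r + Real.log x) (gammaMeasure k r) := by
    rw [integrable_gammaMeasure_iff hk hr]
    refine IntegrableOn.congr_fun ?_ heq measurableSet_Ioi
    refine Integrable.const_mul ?_ _
    exact (integrableOn_Ioi_comp_mul_left_iff
      (fun x : ℝ => x ^ (k - 1) * (Real.log x * Real.exp (-x))) 0 hr).2 (by simpa using h1)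
  have hlog : Integrable Real.log (gammaMeasure k r) := by
    refine (hint.sub (integrable_const (Real.log r))).congr (ae_of_all _ fun x => ?_)
    simp
  refine ⟨hlog, ?_⟩
  have hs : ∫ x, (Real.log r + Real.log x) ∂gammaMeasure k r = (Complex.digamma k).re := by
    rw [integral_gammaMeasure hk hr, ← setIntegral_congr_fun measurableSet_Ioi heq,
      integral_const_mul, integral_comp_mul_left_Ioi
      (fun x : ℝ => x ^ (k - 1) * (Real.log x * Real.exp (-x))) 0 hr, mul_zero, h2, smul_eq_mul]
    field_simp
  rw [integral_add (integrable_const _) hlog] at hs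
  simp at hs
  linarith

lemma gammaMeasure_real_Iio {k : ℕ} (hk : 0 < k) {r : ℝ} (hr : 0 < r) {x : ℝ} (hx : 0 ≤ x) :
    (gammaMeasure k r).real (Iio x) = ∫ t in (0 : ℝ)..x, gammaDensity k r t := by
  have h1 : (gammaMeasure k r).real (Iio x) =
      ∫ t, (Iio x).indicator (fun _ => (1 : ℝ)) t ∂gammaMeasure k r := by
    rw [integral_indicator measurableSet_Iio]
    simp
  rw [h1, integral_gammaMeasure hk hr, intervalIntegral.integral_of_le hx,
    integral_Ioc_eq_integral_Ioo]
  have : ∀ t, gammaDensity k r t • (Iio x).indicator (fun _ => (1 : ℝ)) t =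
      (Iio x).indicator (gammaDensity k r) t := fun t => by
    by_cases ht : t ∈ Iio x <;> simp [ht]
  simp_rw [this]
  rw [setIntegral_indicator measurableSet_Iio, Ioi_inter_Iio]

lemma integral_monomial {k : ℕ} (hk : 0 < k) (r x c : ℝ) :
    ∫ t in (0 : ℝ)..x, r ^ k / (k - 1).factorial * t ^ (k - 1) * c =
      c * ((r * x) ^ k / k.factorial) := by
  obtain ⟨m, rfl⟩ : ∃ m, k = m + 1 := ⟨k - 1, by omega⟩
  have hf : (m.factorial : ℝ) ≠ 0 := by exact_mod_cast m.factorial_ne_zero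
  rw [intervalIntegral.integral_mul_const, intervalIntegral.integral_const_mul]
  simp only [Nat.add_sub_cancel, integral_pow, Nat.factorial_succ]
  push_cast
  field_simp
  simp [mul_pow]
  ring

/-- On `[0, x]` the exponential factor of the density lies between `exp (-(r x))` and 1; what
remains is a monomial. -/
lemma gammaMeasure_real_Iio_bounds {k : ℕ} (hk : 0 < k) {r : ℝ} (hr : 0 < r) {x : ℝ}
    (hx : 0 ≤ x) :
    Real.exp (-(r * x)) * ((r * x) ^ k / k.factorial) ≤ (gammaMeasure k r).real (Iio x) ∧
      (gammaMeasure k r).real (Iio x) ≤ (r * x) ^ k / k.factorial := by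
  rw [gammaMeasure_real_Iio hk hr hx]
  constructor
  · rw [← integral_monomial hk]
    refine intervalIntegral.integral_mono_on hx (Continuous.intervalIntegrable (by fun_prop) _ _)
      ((continuous_gammaDensity k r).intervalIntegrable _ _) fun t ht => ?_
    have := ht.1
    refine mul_le_mul_of_nonneg_left (Real.exp_le_exp.2 ?_) (by positivity)
    nlinarith [ht.2]
  · rw [← one_mul ((r * x) ^ k / _), ← integral_monomial hk]
    refine intervalIntegral.integral_mono_on hx ((continuous_gammaDensity k r).intervalIntegrable _ _)
      (Continuous.intervalIntegrable (by fun_prop) _ _) fun t ht => ?_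
    have := ht.1
    refine mul_le_mul_of_nonneg_left (Real.exp_le_one_iff.2 ?_) (by positivity)
    nlinarith

end Gamma

/-! ### The squared modulus of a circular Gaussian is exponential. -/

section CircularGaussian

lemma measurable_complex_mk : Measurable fun p : ℝ × ℝ => (⟨p.1, p.2⟩ : ℂ) :=
  Complex.measurableEquivRealProd.symm.measurable

instance (v : ℝ≥0) : IsProbabilityMeasure (circularGaussian v) :=
  Measure.isProbabilityMeasure_map measurable_complex_mk.aemeasurable

/-- The two factors stand for the real and imaginary parts. In the product the complex square roots
multiply to `π / b`, so no branch has to be tracked. -/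
lemma integral_cexp_sq_gaussianReal {w : ℝ} (hw : 0 < w) (t : ℝ) :
    (∫ x, Complex.exp (t * x ^ 2 * Complex.I) ∂gaussianReal 0 w.toNNReal) *
      (∫ x, Complex.exp (t * x ^ 2 * Complex.I) ∂gaussianReal 0 w.toNNReal) =
      (1 - t * Complex.I * (2 * w))⁻¹ := by
  have hw0 : (w : ℂ) ≠ 0 := by exact_mod_cast hw.ne'
  have hpi : (Real.pi : ℂ) ≠ 0 := by exact_mod_cast Real.pi_ne_zero
  set b : ℂ := 1 / (2 * w) - t * Complex.I with hb
  have hre : 0 < b.re := by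
    have : b.re = 1 / (2 * w) := by
      rw [hb, Complex.sub_re, show (1 / (2 * w) : ℂ) = ((1 / (2 * w) : ℝ) : ℂ) by push_cast; rfl,
        Complex.ofReal_re]
      simp
    rw [this]; positivity
  have hb0 : b ≠ 0 := fun h => by simp [h] at hre
  have h1 : ∫ x, Complex.exp (t * x ^ 2 * Complex.I) ∂gaussianReal 0 w.toNNReal =
      (((√(2 * Real.pi * w))⁻¹ : ℝ) : ℂ) * (Real.pi / b) ^ (1 / 2 : ℂ) := by
    rw [integral_gaussianReal_eq_integral_smul (Real.toNNReal_pos.2 hw).ne',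
      ← integral_gaussian_complex hre, ← integral_const_mul]
    refine integral_congr_ae (ae_of_all _ fun x => ?_)
    simp only [gaussianPDFReal, Real.coe_toNNReal _ hw.le, Complex.real_smul, sub_zero]
    push_cast
    rw [mul_assoc, ← Complex.exp_add]
    congr 2
    rw [hb]
    field_simp
    ring
  have h2 : (Real.pi / b) ^ (1 / 2 : ℂ) * (Real.pi / b) ^ (1 / 2 : ℂ) = Real.pi / b := by
    rw [← Complex.cpow_add _ _ (div_ne_zero hpi hb0)]
    norm_num
  have h3 : (((√(2 * Real.pi * w))⁻¹ : ℝ) : ℂ) * (((√(2 * Real.pi * w))⁻¹ : ℝ) : ℂ) =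
      (2 * Real.pi * w : ℂ)⁻¹ := by
    rw [← Complex.ofReal_mul, ← mul_inv, Real.mul_self_sqrt (by positivity)]
    simp
  rw [h1, mul_mul_mul_comm, h2, h3]
  have h4 : (1 - t * Complex.I * (2 * w)) = 2 * w * b := by rw [hb]; field_simp
  rw [h4]
  field_simp

lemma map_norm_sq_circularGaussian {v : ℝ} (hv : 0 < v) :
    (circularGaussian v.toNNReal).map (fun z => ‖z‖ ^ 2) = gammaMeasure (1 : ℕ) v⁻¹ := by
  have : IsProbabilityMeasure (gammaMeasure (1 : ℕ) v⁻¹) :=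
    isProbabilityMeasure_gammaMeasure (by simp) (inv_pos.2 hv)
  have : IsProbabilityMeasure ((circularGaussian v.toNNReal).map (fun z => ‖z‖ ^ 2)) :=
    Measure.isProbabilityMeasure_map (by fun_prop)
  refine Measure.ext_of_charFun (funext fun t => ?_)
  rw [charFun_gammaMeasure one_pos (inv_pos.2 hv), charFun_apply_real,
    integral_map (by fun_prop) (Continuous.aestronglyMeasurable (by fun_prop)), circularGaussian,
    integral_map measurable_complex_mk.aemeasurable
      (Continuous.aestronglyMeasurable (by fun_prop))]
  have h1 : ∀ p : ℝ × ℝ, Complex.exp (t * ((‖(⟨p.1, p.2⟩ : ℂ)‖ ^ 2 : ℝ) : ℂ) * Complex.I) =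
      Complex.exp (t * p.1 ^ 2 * Complex.I) * Complex.exp (t * p.2 ^ 2 * Complex.I) := fun p => by
    rw [← Complex.normSq_eq_norm_sq, Complex.normSq_mk, ← Complex.exp_add]
    push_cast
    ring_nf
  have h2 : v.toNNReal / 2 = (v / 2).toNNReal := by
    rw [Real.toNNReal_div hv.le]; simp
  simp_rw [h1]
  rw [integral_prod_mul (fun x : ℝ => Complex.exp (t * x ^ 2 * Complex.I))
    (fun x : ℝ => Complex.exp (t * x ^ 2 * Complex.I)), h2,
    integral_cexp_sq_gaussianReal (half_pos hv)]
  push_cast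
  rw [pow_one, div_inv_eq_mul, mul_div_cancel₀ _ two_ne_zero]

end CircularGaussian

/-! ### The channel gain as a mixture of gamma laws. -/

namespace SIMOChannel

variable {D : ℕ} (C : SIMOChannel D)

/-- The law of the channel gain, as a mixture of gamma laws. -/
def gainLaw : Measure ℝ := Measure.sum fun q =>
  ENNReal.ofReal (C.sigmaSqMin ^ D / (∏ i, C.sigmaSq i) * C.psiCoeff q) •
    gammaMeasure (D + q : ℕ) C.sigmaSqMin⁻¹

lemma mixWeight_nonneg (hD : 0 < D) (q : ℕ) :
    0 ≤ C.sigmaSqMin ^ D / (∏ i, C.sigmaSq i) * C.psiCoeff q :=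
  mul_nonneg (div_nonneg (pow_nonneg (C.sigmaSqMin_pos hD).le _)
    (Finset.prod_nonneg fun i _ => (C.sigmaSq_pos i).le)) ((C.psiCoeff_hasSum hD).1 q)

lemma isProbabilityMeasure_component (hD : 0 < D) (q : ℕ) :
    IsProbabilityMeasure (gammaMeasure (D + q : ℕ) C.sigmaSqMin⁻¹) :=
  isProbabilityMeasure_gammaMeasure (by exact_mod_cast (by omega : 0 < D + q))
    (inv_pos.2 (C.sigmaSqMin_pos hD))

/-- Finiteness is enough for uniqueness of characteristic functions; that the mass is 1 then follows
from `map_gain`. -/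
lemma isFiniteMeasure_gainLaw (hD : 0 < D) : IsFiniteMeasure C.gainLaw := by
  constructor
  have := C.isProbabilityMeasure_component hD
  rw [gainLaw, Measure.sum_apply _ MeasurableSet.univ]
  simp only [Measure.smul_apply, measure_univ, smul_eq_mul, mul_one]
  exact ((C.summable_psiCoeff hD).mul_left _).tsum_ofReal_lt_top

lemma hasSum_integral_gainLaw (hD : 0 < D) {E : Type*} [NormedAddCommGroup E] [NormedSpace ℝ E]
    {f : ℝ → E} (hf : Integrable f C.gainLaw) :
    HasSum (fun q => (C.sigmaSqMin ^ D / (∏ i, C.sigmaSq i) * C.psiCoeff q) •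
      ∫ x, f x ∂gammaMeasure (D + q : ℕ) C.sigmaSqMin⁻¹) (∫ x, f x ∂C.gainLaw) := by
  have h := hasSum_integral_measure hf
  simp only [integral_smul_measure] at h
  simpa only [ENNReal.toReal_ofReal (C.mixWeight_nonneg hD _), gainLaw] using h

/-- Summing over the components evaluates the generating function at `u = w⁻¹`. This point lies in
the closed unit disc because `w` has real part 1. -/
lemma charFun_gainLaw (hD : 0 < D) (t : ℝ) :
    charFun C.gainLaw t = ∏ i, (1 - t * Complex.I * C.sigmaSq i)⁻¹ := by
  have hm := C.sigmaSqMin_pos hD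
  have hm0 : (C.sigmaSqMin : ℂ) ≠ 0 := by exact_mod_cast hm.ne'
  have := C.isFiniteMeasure_gainLaw hD
  set w : ℂ := 1 - t * Complex.I * C.sigmaSqMin with hw
  have hre : ∀ s : ℝ, (1 - t * Complex.I * s : ℂ).re = 1 := fun s => by simp
  have hw1 : 1 ≤ ‖w‖ := by
    have := Complex.abs_re_le_norm w
    rwa [hw, hre, abs_one, ← hw] at this
  have hw0 : w ≠ 0 := norm_pos_iff.1 (by linarith)
  have hu : ‖w⁻¹‖ ≤ 1 := by rw [norm_inv]; exact inv_le_one_of_one_le₀ hw1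
  have hint : Integrable (fun x : ℝ => Complex.exp (t * x * Complex.I)) C.gainLaw := by
    refine Integrable.of_bound (Continuous.aestronglyMeasurable (by fun_prop)) 1
      (ae_of_all _ fun x => ?_)
    rw [← Complex.ofReal_mul, Complex.norm_exp_ofReal_mul_I]
  have h1 := C.hasSum_integral_gainLaw hD hint
  simp only [← charFun_apply_real] at h1
  have h2 := ((C.psiCoeff_hasSum hD).2 _ hu).mul_left
    (((C.sigmaSqMin ^ D / (∏ i, C.sigmaSq i) : ℝ) : ℂ) * w⁻¹ ^ D)
  have h3 : ∀ q, (C.sigmaSqMin ^ D / (∏ i, C.sigmaSq i) * C.psiCoeff q) •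
      charFun (gammaMeasure (D + q : ℕ) C.sigmaSqMin⁻¹) t =
      ((C.sigmaSqMin ^ D / (∏ i, C.sigmaSq i) : ℝ) : ℂ) * w⁻¹ ^ D *
        (C.psiCoeff q * w⁻¹ ^ q) := fun q => by
    rw [charFun_gammaMeasure (by omega) (inv_pos.2 hm), Complex.real_smul, Complex.ofReal_inv,
      div_inv_eq_mul, ← hw, pow_add]
    push_cast
    ring
  simp only [h3] at h1
  rw [h1.unique h2]
  have hcD : ((C.sigmaSqMin ^ D / (∏ i, C.sigmaSq i) : ℝ) : ℂ) * w⁻¹ ^ D =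
      ∏ i, ((C.sigmaSqMin : ℂ) / C.sigmaSq i * w⁻¹) := by
    rw [Finset.prod_mul_distrib, Finset.prod_div_distrib]
    simp
  rw [hcD, ← Finset.prod_mul_distrib]
  refine Finset.prod_congr rfl fun i _ => ?_
  have hi0 : (C.sigmaSq i : ℂ) ≠ 0 := by exact_mod_cast (C.sigmaSq_pos i).ne'
  rw [mul_assoc, ← mul_inv]
  have h5 : w * (1 - ((1 - C.sigmaSqMin / C.sigmaSq i : ℝ) : ℂ) * w⁻¹) =
      C.sigmaSqMin / C.sigmaSq i * (1 - t * Complex.I * C.sigmaSq i) := by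
    rw [mul_sub, mul_left_comm, mul_inv_cancel₀ hw0, hw]
    push_cast
    field_simp
    ring
  rw [h5, mul_inv, ← mul_assoc, mul_inv_cancel₀ (div_ne_zero hm0 hi0), one_mul]

variable {Ω : Type*} [MeasurableSpace Ω] {P : Measure Ω}
  {h : Fin D → Ω → ℂ} {C}

lemma IsRayleigh.map_norm_sq (hh : C.IsRayleigh P h) (i : Fin D) :
    P.map (fun ω => ‖h i ω‖ ^ 2) = gammaMeasure (1 : ℕ) (C.sigmaSq i)⁻¹ := by
  rw [← map_norm_sq_circularGaussian (C.sigmaSq_pos i), ← (hh.2 i).map_eq,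
    AEMeasurable.map_map_of_aemeasurable (by fun_prop) (hh.2 i).aemeasurable]
  rfl

lemma IsRayleigh.aemeasurable_norm_sq (hh : C.IsRayleigh P h) (i : Fin D) :
    AEMeasurable (fun ω => ‖h i ω‖ ^ 2) P :=
  (hh.2 i).aemeasurable.norm.pow_const 2

lemma IsRayleigh.aemeasurable_gain (hh : C.IsRayleigh P h) :
    AEMeasurable (fun ω => ∑ i, ‖h i ω‖ ^ 2) P :=
  Finset.aemeasurable_fun_sum _ fun i _ => hh.aemeasurable_norm_sq i

lemma IsRayleigh.map_gain [IsProbabilityMeasure P] (hD : 0 < D) (hh : C.IsRayleigh P h) :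
    P.map (fun ω => ∑ i, ‖h i ω‖ ^ 2) = C.gainLaw := by
  have := C.isFiniteMeasure_gainLaw hD
  refine Measure.ext_of_charFun (funext fun t => ?_)
  have hind : iIndepFun (fun i ω => ‖h i ω‖ ^ 2) P :=
    hh.1.comp (fun _ z => ‖z‖ ^ 2) fun _ => by fun_prop
  rw [hind.charFun_map_fun_sum_eq_prod hh.aemeasurable_norm_sq, charFun_gainLaw C hD,
    Finset.prod_apply]
  refine Finset.prod_congr rfl fun i _ => ?_
  rw [hh.map_norm_sq, charFun_gammaMeasure one_pos (inv_pos.2 (C.sigmaSq_pos i)), pow_one,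
    Complex.ofReal_inv, div_inv_eq_mul]

lemma IsRayleigh.ae_norm_sq_pos (hh : C.IsRayleigh P h) (i : Fin D) :
    ∀ᵐ ω ∂P, 0 < ‖h i ω‖ ^ 2 := by
  refine ae_of_ae_map (p := fun x : ℝ => 0 < x) (hh.aemeasurable_norm_sq i) ?_
  rw [hh.map_norm_sq]
  exact gammaMeasure_ae_pos one_pos _

lemma IsRayleigh.integrable_norm_sq (hh : C.IsRayleigh P h) (i : Fin D) :
    Integrable (fun ω => ‖h i ω‖ ^ 2) P := by
  have h1 := integrable_id_gammaMeasure one_pos (inv_pos.2 (C.sigmaSq_pos i))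
  rw [← hh.map_norm_sq] at h1
  exact h1.comp_aemeasurable (hh.aemeasurable_norm_sq i)

lemma IsRayleigh.integrable_gain (hh : C.IsRayleigh P h) :
    Integrable (fun ω => ∑ i, ‖h i ω‖ ^ 2) P :=
  integrable_finsetSum _ fun i _ => hh.integrable_norm_sq i

lemma IsRayleigh.ae_gain_pos (hD : 0 < D) (hh : C.IsRayleigh P h) :
    ∀ᵐ ω ∂P, 0 < ∑ i, ‖h i ω‖ ^ 2 := by
  filter_upwards [hh.ae_norm_sq_pos ⟨0, hD⟩] with ω hω
  exact hω.trans_le (Finset.single_le_sum (f := fun i => ‖h i ω‖ ^ 2)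
    (fun i _ => by positivity) (Finset.mem_univ _))

/-- The logarithm of the gain is squeezed between the logarithm of a single summand, integrable by
the gamma computation, and the gain minus 1. -/
lemma IsRayleigh.integrable_log_gain (hD : 0 < D) (hh : C.IsRayleigh P h) :
    Integrable (fun ω => Real.log (∑ i, ‖h i ω‖ ^ 2)) P := by
  have h1 := (integrable_log_gammaMeasure_and_integral one_pos
    (inv_pos.2 (C.sigmaSq_pos ⟨0, hD⟩))).1
  rw [← hh.map_norm_sq] at h1
  have h2 := h1.comp_aemeasurable (hh.aemeasurable_norm_sq _)
  refine Integrable.mono' (hh.integrable_gain.add h2.abs)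
    (Real.measurable_log.comp_aemeasurable hh.aemeasurable_gain).aestronglyMeasurable ?_
  filter_upwards [hh.ae_norm_sq_pos ⟨0, hD⟩] with ω hω
  have hle : ‖h ⟨0, hD⟩ ω‖ ^ 2 ≤ ∑ i, ‖h i ω‖ ^ 2 :=
    Finset.single_le_sum (f := fun i => ‖h i ω‖ ^ 2) (fun i _ => by positivity) (Finset.mem_univ _)
  have hpos := hω.trans_le hle
  simp only [Pi.add_apply, Function.comp_apply]
  rw [Real.norm_eq_abs, abs_le]
  constructor
  · have := Real.log_le_log hω hle
    have := neg_abs_le (Real.log (‖h ⟨0, hD⟩ ω‖ ^ 2))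
    linarith
  · have := Real.log_le_sub_one_of_pos hpos
    have := abs_nonneg (Real.log (‖h ⟨0, hD⟩ ω‖ ^ 2))
    linarith

lemma IsRayleigh.hasSum_digammaTerm [IsProbabilityMeasure P] (hD : 0 < D) (hh : C.IsRayleigh P h) :
    HasSum (fun q => C.sigmaSqMin ^ D / (∏ i, C.sigmaSq i) * C.digammaTerm q)
      (∫ ω, Real.logb 2 (∑ i, ‖h i ω‖ ^ 2) ∂P) := by
  have hm := C.sigmaSqMin_pos hD
  have hlog : Integrable Real.log C.gainLaw := by
    rw [← hh.map_gain hD]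
    exact (integrable_map_measure Real.measurable_log.aestronglyMeasurable
      hh.aemeasurable_gain).2 (hh.integrable_log_gain hD)
  have h1 := (C.hasSum_integral_gainLaw hD hlog).div_const (Real.log 2)
  have h2 : (∫ x, Real.log x ∂C.gainLaw) / Real.log 2 =
      ∫ ω, Real.logb 2 (∑ i, ‖h i ω‖ ^ 2) ∂P := by
    rw [← hh.map_gain hD, integral_map hh.aemeasurable_gain
      Real.measurable_log.aestronglyMeasurable, ← integral_div]
    rfl
  rw [h2] at h1
  refine h1.congr_fun fun q => ?_
  rw [(integrable_log_gammaMeasure_and_integral (by omega) (inv_pos.2 hm)).2, Real.log_inv,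
    digammaTerm, smul_eq_mul]
  ring

end SIMOChannel

/-! ### Orthogonality of the modes and the signal-to-noise ratio. -/

lemma integral_Icc_cexp_int {L : ℝ} (hL : 0 < L) (n : ℤ) :
    ∫ x in Set.Icc (-(L / 2)) (L / 2), Complex.exp (2 * Real.pi * Complex.I * n / L * x) =
      if n = 0 then (L : ℂ) else 0 := by
  rw [integral_Icc_eq_integral_Ioc, ← intervalIntegral.integral_of_le (by linarith)]
  split_ifs with hn
  · simp [hn]
  · have hL0 : (L : ℂ) ≠ 0 := by exact_mod_cast hL.ne'
    have hn0 : (n : ℂ) ≠ 0 := by exact_mod_cast hn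
    have hc : 2 * Real.pi * Complex.I * n / L ≠ 0 :=
      div_ne_zero (mul_ne_zero Complex.two_pi_I_ne_zero hn0) hL0
    rw [integral_exp_mul_complex hc, div_eq_zero_iff, sub_eq_zero]
    left
    -- The exponents at the two endpoints differ by `2πi n`.
    rw [Complex.exp_eq_exp_iff_exists_int]
    refine ⟨n, ?_⟩
    push_cast
    field_simp
    ring

namespace SIMOChannel

variable {D : ℕ} (C : SIMOChannel D)

lemma txArea_pos : 0 < C.txArea := by
  have h1 := C.Ltx_pos
  have h2 := C.Ltz_pos
  rw [txArea, txAperture, Measure.volume_eq_prod, measureReal_prod_prod,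
    Real.volume_real_Icc_of_le (by linarith), Real.volume_real_Icc_of_le (by linarith)]
  exact mul_pos (by linarith) (by linarith)

lemma rxArea_eq : C.rxArea = C.Lrx * C.Lrz := by
  have h1 := C.Lrx_pos
  have h2 := C.Lrz_pos
  rw [rxArea, rxAperture, Measure.volume_eq_prod, measureReal_prod_prod,
    Real.volume_real_Icc_of_le (by linarith), Real.volume_real_Icc_of_le (by linarith)]
  ring

lemma rxArea_pos : 0 < C.rxArea := by
  rw [rxArea_eq]; exact mul_pos C.Lrx_pos C.Lrz_pos

lemma continuous_mode (i : Fin D) : Continuous (C.mode i) := by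
  unfold mode; fun_prop

lemma integral_conj_mode_mul_mode (i j : Fin D) :
    ∫ r in C.rxAperture, conj (C.mode i r) * C.mode j r = if i = j then (C.rxArea : ℂ) else 0 := by
  have h1 : ∀ r : ℝ × ℝ, conj (C.mode i r) * C.mode j r =
      Complex.exp (2 * Real.pi * Complex.I * ((C.freq j).1 - (C.freq i).1 : ℤ) / C.Lrx * r.1) *
      Complex.exp (2 * Real.pi * Complex.I * ((C.freq j).2 - (C.freq i).2 : ℤ) / C.Lrz * r.2) :=
    fun r => by
      rw [mode, mode, ← Complex.exp_conj, ← Complex.exp_add, ← Complex.exp_add]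
      congr 1
      simp only [map_mul, map_add, map_div₀, map_ofNat, map_intCast, Complex.conj_ofReal,
        Complex.conj_I]
      push_cast
      ring
  simp_rw [h1]
  rw [rxAperture, Measure.volume_eq_prod, setIntegral_prod_mul
    (fun x : ℝ => Complex.exp (2 * Real.pi * Complex.I * ((C.freq j).1 - (C.freq i).1 : ℤ) /
      C.Lrx * x))
    (fun x : ℝ => Complex.exp (2 * Real.pi * Complex.I * ((C.freq j).2 - (C.freq i).2 : ℤ) /
      C.Lrz * x)), integral_Icc_cexp_int C.Lrx_pos, integral_Icc_cexp_int C.Lrz_pos]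
  by_cases hij : i = j
  · simp [hij, rxArea_eq]
  · rw [if_neg hij]
    have hne : C.freq j ≠ C.freq i := fun h => hij (C.freq_injective h.symm)
    rw [Ne, Prod.ext_iff, not_and_or] at hne
    rcases hne with hne | hne
    · rw [if_neg (sub_ne_zero.2 hne), zero_mul]
    · rw [if_neg (sub_ne_zero.2 hne), mul_zero]

lemma effective_eq (h : Fin D → ℂ) (i : Fin D) :
    C.effective h i = C.waveform * C.txArea * C.rxArea * h i := by
  have h1 : ∀ r, conj (C.mode i r) * C.receivedField h r =
      ∑ j, C.waveform * C.txArea * h j * (conj (C.mode i r) * C.mode j r) := fun r => by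
    rw [receivedField, response, Finset.mul_sum, Finset.mul_sum]
    exact Finset.sum_congr rfl fun j _ => by ring
  have hcomp : IsCompact C.rxAperture := isCompact_Icc.prod isCompact_Icc
  simp_rw [effective, h1]
  rw [integral_finsetSum]
  · simp_rw [integral_const_mul, integral_conj_mode_mul_mode]
    simp
    ring
  · intro j _
    have := C.continuous_mode i
    have := C.continuous_mode j
    have hcont : Continuous fun r =>
        C.waveform * C.txArea * h j * (conj (C.mode i r) * C.mode j r) := by fun_prop
    exact hcont.continuousOn.integrableOn_compact hcomp

lemma combinedSNR_effective (γ : ℝ) (h : Fin D → ℂ) :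
    C.combinedSNR (C.effective h) (C.symbolPower γ) h =
      γ * (C.txArea * C.rxArea) * ∑ i, ‖h i‖ ^ 2 := by
  have ht := C.txArea_pos
  have hr := C.rxArea_pos
  have hn := C.noise_pos
  have hw : 0 < ‖C.waveform‖ := norm_pos_iff.2 C.waveform_ne_zero
  set e : ℝ := ‖C.waveform‖ ^ 2 * C.txArea ^ 2 * C.rxArea ^ 2 * ∑ i, ‖h i‖ ^ 2 with he
  have h1 : ∑ i, conj (C.effective h i) * C.effective h i = (e : ℂ) := by
    have : ∀ i, conj (C.effective h i) * C.effective h i =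
        ((‖C.waveform‖ ^ 2 * C.txArea ^ 2 * C.rxArea ^ 2 * ‖h i‖ ^ 2 : ℝ) : ℂ) := fun i => by
      rw [Complex.conj_mul', effective_eq]
      simp only [norm_mul, Complex.norm_real, Real.norm_of_nonneg ht.le, Real.norm_of_nonneg hr.le]
      push_cast
      ring
    simp_rw [this]
    rw [← Complex.ofReal_sum, ← Finset.mul_sum]
  have h2 : ∑ i, ∑ j, conj (C.effective h i) * C.noiseCov i j * C.effective h j =
      ((C.noise * C.rxArea * e : ℝ) : ℂ) := by
    simp only [noiseCov, integral_conj_mode_mul_mode, mul_ite, mul_zero, ite_mul, zero_mul,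
      Finset.sum_ite_eq, Finset.mem_univ, if_true]
    push_cast
    rw [← h1, Finset.mul_sum]
    exact Finset.sum_congr rfl fun i _ => by ring
  rw [combinedSNR, h1, h2, Complex.ofReal_re, Complex.norm_real, Real.norm_eq_abs, sq_abs,
    symbolPower]
  -- The ratio is `p * e ^ 2 / (noise * rxArea * e)`. If `e = 0`, division by zero gives 0, which is
  -- also the right-hand side.
  by_cases hs : ∑ i, ‖h i‖ ^ 2 = 0
  · have : e = 0 := by rw [he, hs, mul_zero]
    simp [this, hs]
  · rw [he]
    field_simp

lemma rate_eq (γ : ℝ) (h : Fin D → ℂ) :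
    C.rate γ h = Real.logb 2 (1 + γ * (C.txArea * C.rxArea) * ∑ i, ‖h i‖ ^ 2) := by
  rw [rate, combinedSNR_effective]

lemma rate_lt_iff {γ : ℝ} (hγ : 0 < γ) (R : ℝ) (h : Fin D → ℂ) :
    C.rate γ h < R ↔ ∑ i, ‖h i‖ ^ 2 < ((2 : ℝ) ^ R - 1) / (γ * (C.txArea * C.rxArea)) := by
  have hA := mul_pos hγ (mul_pos C.txArea_pos C.rxArea_pos)
  have hS : 0 ≤ ∑ i, ‖h i‖ ^ 2 := Finset.sum_nonneg fun i _ => by positivity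
  rw [rate_eq, Real.logb_lt_iff_lt_rpow one_lt_two (by positivity), lt_div_iff₀ hA,
    ← lt_sub_iff_add_lt', mul_comm (∑ i, ‖h i‖ ^ 2)]

/-! ### Mass of the gain law near zero. -/

lemma hasSum_gainLaw_Iio (hD : 0 < D) (x : ℝ) :
    HasSum (fun q => C.sigmaSqMin ^ D / (∏ i, C.sigmaSq i) * C.psiCoeff q *
      (gammaMeasure (D + q : ℕ) C.sigmaSqMin⁻¹).real (Set.Iio x)) (C.gainLaw.real (Set.Iio x)) := by
  have := C.isFiniteMeasure_gainLaw hD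
  have h := C.hasSum_integral_gainLaw hD (f := (Set.Iio x).indicator 1)
    ((integrable_const (1 : ℝ)).indicator measurableSet_Iio)
  simpa only [integral_indicator_one measurableSet_Iio, smul_eq_mul] using h

/-- The component of shape `D + q` has mass of order `x ^ (D + q)` near 0, so only `q = 0` survives
division by `x ^ D`. Limit and sum are exchanged by dominated convergence for series. -/
lemma tendsto_gainLaw_Iio_div_pow (hD : 0 < D) :
    Tendsto (fun x => C.gainLaw.real (Set.Iio x) / x ^ D) (𝓝[>] 0)
      (𝓝 (1 / ((D.factorial : ℝ) * ∏ i, C.sigmaSq i))) := by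
  have hm := C.sigmaSqMin_pos hD
  set r := C.sigmaSqMin⁻¹ with hr_def
  have hr : 0 < r := inv_pos.2 hm
  have hw := C.mixWeight_nonneg hD
  set w : ℕ → ℝ := fun q => C.sigmaSqMin ^ D / (∏ i, C.sigmaSq i) * C.psiCoeff q with hw_def
  have hpos : ∀ᶠ x : ℝ in 𝓝[>] 0, 0 < x := eventually_mem_nhdsWithin
  have hub : ∀ q : ℕ, ∀ x : ℝ, 0 < x → (gammaMeasure (D + q : ℕ) r).real (Set.Iio x) / x ^ D ≤
      r ^ (D + q) / (D + q).factorial * x ^ q := fun q x hx => by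
    rw [div_le_iff₀ (by positivity)]
    refine (gammaMeasure_real_Iio_bounds (by omega) hr hx.le).2.trans (le_of_eq ?_)
    rw [mul_pow, pow_add x]
    ring
  have hlb : ∀ q : ℕ, ∀ x : ℝ, 0 < x → Real.exp (-(r * x)) * (r ^ (D + q) / (D + q).factorial * x ^ q)
      ≤ (gammaMeasure (D + q : ℕ) r).real (Set.Iio x) / x ^ D := fun q x hx => by
    rw [le_div_iff₀ (by positivity)]
    refine (le_of_eq ?_).trans (gammaMeasure_real_Iio_bounds (by omega) hr hx.le).1
    rw [mul_pow, pow_add x]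
    ring
  have hlim : ∀ q : ℕ, Tendsto (fun x => w q *
      ((gammaMeasure (D + q : ℕ) r).real (Set.Iio x) / x ^ D)) (𝓝[>] 0)
      (𝓝 (w q * (r ^ (D + q) / (D + q).factorial * 0 ^ q))) := fun q => by
    refine Tendsto.const_mul _ ?_
    have hc1 : Tendsto (fun x : ℝ => r ^ (D + q) / (D + q).factorial * x ^ q) (𝓝[>] 0)
        (𝓝 (r ^ (D + q) / (D + q).factorial * 0 ^ q)) :=
      tendsto_nhdsWithin_of_tendsto_nhds (Continuous.tendsto (by fun_prop) 0)
    have hc2 : Tendsto (fun x : ℝ => Real.exp (-(r * x)) *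
        (r ^ (D + q) / (D + q).factorial * x ^ q)) (𝓝[>] 0)
        (𝓝 (r ^ (D + q) / (D + q).factorial * 0 ^ q)) := by
      have h : Continuous fun x : ℝ => Real.exp (-(r * x)) *
        (r ^ (D + q) / (D + q).factorial * x ^ q) := by fun_prop
      simpa using tendsto_nhdsWithin_of_tendsto_nhds (s := Set.Ioi 0) (h.tendsto 0)
    refine tendsto_of_tendsto_of_tendsto_of_le_of_le' hc2 hc1 ?_ ?_
    · filter_upwards [hpos] with x hx using hlb q x hx
    · filter_upwards [hpos] with x hx using hub q x hx
  have hle1 : ∀ᶠ x : ℝ in 𝓝[>] 0, x ≤ 1 := by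
    filter_upwards [Ioo_mem_nhdsGT (zero_lt_one (α := ℝ))] with x hx using hx.2.le
  -- For `x ≤ 1` each component contributes at most `r ^ (D + q) / (D + q)!`, a single term of the
  -- series for `exp r`; this bound is uniform in `q`.
  have hbound : ∀ᶠ x : ℝ in 𝓝[>] 0, ∀ q : ℕ,
      ‖w q * ((gammaMeasure (D + q : ℕ) r).real (Set.Iio x) / x ^ D)‖ ≤ w q * Real.exp r := by
    filter_upwards [hpos, hle1] with x hx hx1 q
    rw [Real.norm_of_nonneg (mul_nonneg (hw q) (by positivity))]
    refine mul_le_mul_of_nonneg_left ((hub q x hx).trans ?_) (hw q)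
    refine (mul_le_of_le_one_right (by positivity) (pow_le_one₀ hx.le hx1)).trans ?_
    exact Real.pow_div_factorial_le_exp r hr.le _
  have hsum : Summable fun q => w q * Real.exp r :=
    ((C.summable_psiCoeff hD).mul_left _).mul_right _
  have h := tendsto_tsum_of_dominated_convergence hsum hlim hbound
  have htsum : ∑' q, w q * (r ^ (D + q) / (D + q).factorial * 0 ^ q) =
      1 / ((D.factorial : ℝ) * ∏ i, C.sigmaSq i) := by
    rw [tsum_eq_single 0 (fun q hq => by simp [hq])]
    simp only [hw_def, hr_def, psiCoeff, add_zero, pow_zero, mul_one, inv_pow]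
    field_simp
  rw [htsum] at h
  refine h.congr fun x => ?_
  have h2 := (C.hasSum_gainLaw_Iio hD x).div_const (x ^ D)
  rw [← h2.tsum_eq]
  exact tsum_congr fun q => (mul_div_assoc _ _ _).symm

/-! ### Outage probability, diversity order and array gain. -/

variable {Ω : Type*} [MeasurableSpace Ω] {P : Measure Ω}
  {h : Fin D → Ω → ℂ} {C}

lemma IsRayleigh.outage_eq [IsProbabilityMeasure P] (hD : 0 < D) (hh : C.IsRayleigh P h) {γ : ℝ} (hγ : 0 < γ) (R : ℝ) :
    C.outage P h γ R =
      C.gainLaw.real (Set.Iio (((2 : ℝ) ^ R - 1) / (γ * (C.txArea * C.rxArea)))) := by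
  rw [outage, ← hh.map_gain hD, map_measureReal_apply_of_aemeasurable hh.aemeasurable_gain
    measurableSet_Iio]
  simp_rw [C.rate_lt_iff hγ]
  rfl

/-- The target rate may vary with `γ`, so that the lemma serves both fixed rates and rates growing
like `r log₂ (1 + γ)`. -/
lemma IsRayleigh.tendsto_outage_div_pow [IsProbabilityMeasure P] (hD : 0 < D) (hh : C.IsRayleigh P h) {R : ℝ → ℝ}
    (hR : ∀ γ, 0 < γ → 0 < R γ)
    (hlim : Tendsto (fun γ => ((2 : ℝ) ^ R γ - 1) / (γ * (C.txArea * C.rxArea))) atTop (𝓝 0)) :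
    Tendsto (fun γ => C.outage P h γ (R γ) /
      (((2 : ℝ) ^ R γ - 1) / (γ * (C.txArea * C.rxArea))) ^ D) atTop
      (𝓝 (1 / ((D.factorial : ℝ) * ∏ i, C.sigmaSq i))) := by
  have hA := mul_pos C.txArea_pos C.rxArea_pos
  have hlim' : Tendsto (fun γ => ((2 : ℝ) ^ R γ - 1) / (γ * (C.txArea * C.rxArea))) atTop
      (𝓝[>] 0) := by
    refine tendsto_nhdsWithin_iff.2 ⟨hlim, ?_⟩
    filter_upwards [eventually_gt_atTop 0] with γ hγ
    exact div_pos (sub_pos.2 (Real.one_lt_rpow one_lt_two (hR γ hγ))) (mul_pos hγ hA)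
  refine ((C.tendsto_gainLaw_Iio_div_pow hD).comp hlim').congr' ?_
  filter_upwards [eventually_gt_atTop 0] with γ hγ
  rw [hh.outage_eq hD hγ]
  rfl

lemma IsRayleigh.outage_isEquivalent [IsProbabilityMeasure P] (hD : 0 < D) (hh : C.IsRayleigh P h) {R : ℝ} (hR : 0 < R) :
    (fun γ : ℝ => C.outage P h γ R) ~[atTop]
      (fun γ : ℝ => (((2 : ℝ) ^ R - 1) / (C.txArea * C.rxArea)) ^ D *
        (1 / ((D.factorial : ℝ) * ∏ i, C.sigmaSq i)) * (1 / γ ^ D)) := by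
  have hK : 0 < 1 / ((D.factorial : ℝ) * ∏ i, C.sigmaSq i) :=
    one_div_pos.2 (mul_pos (by positivity) (Finset.prod_pos fun i _ => C.sigmaSq_pos i))
  have hlim : Tendsto (fun γ => ((2 : ℝ) ^ R - 1) / (γ * (C.txArea * C.rxArea))) atTop (𝓝 0) :=
    tendsto_const_nhds.div_atTop
      (tendsto_id.atTop_mul_const (mul_pos C.txArea_pos C.rxArea_pos))
  have h1 := (hh.tendsto_outage_div_pow hD (R := fun _ => R) (fun _ _ => hR) hlim).div_const
    (1 / ((D.factorial : ℝ) * ∏ i, C.sigmaSq i))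
  rw [div_self hK.ne'] at h1
  refine isEquivalent_of_tendsto_one (h1.congr' ?_)
  filter_upwards [eventually_gt_atTop 0] with γ hγ
  rw [Pi.div_apply, div_div]
  congr 1
  rw [mul_comm γ, ← div_div, div_pow _ γ]
  ring

lemma two_rpow_mul_logb {γ : ℝ} (hγ : 0 < γ) (r : ℝ) :
    (2 : ℝ) ^ (r * Real.logb 2 (1 + γ)) = (1 + γ) ^ r := by
  rw [mul_comm, Real.rpow_mul two_pos.le, Real.rpow_logb two_pos (by norm_num) (by linarith)]

lemma tendsto_threshold_mul_rpow {r : ℝ} (hr : 0 < r) :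
    Tendsto (fun γ => ((2 : ℝ) ^ (r * Real.logb 2 (1 + γ)) - 1) / (γ * (C.txArea * C.rxArea)) *
      γ ^ (1 - r)) atTop (𝓝 (1 / (C.txArea * C.rxArea))) := by
  have h1 : Tendsto (fun γ : ℝ => (γ⁻¹ + 1) ^ r) atTop (𝓝 1) := by
    have h := (tendsto_inv_atTop_zero (𝕜 := ℝ)).add_const 1
    rw [zero_add] at h
    simpa using h.rpow_const (p := r) (Or.inl one_ne_zero)
  have h2 := (h1.sub (tendsto_rpow_neg_atTop hr)).div_const (C.txArea * C.rxArea)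
  rw [sub_zero] at h2
  refine h2.congr' ?_
  filter_upwards [eventually_gt_atTop 0] with γ hγ
  have h3 : (γ⁻¹ + 1) = (1 + γ) / γ := by field_simp
  rw [two_rpow_mul_logb hγ, h3, Real.div_rpow (by positivity) hγ.le, Real.rpow_neg hγ.le,
    Real.rpow_sub hγ, Real.rpow_one]
  field_simp

lemma IsRayleigh.tendsto_outageAt [IsProbabilityMeasure P] (hD : 0 < D) (hh : C.IsRayleigh P h) {r : ℝ} (hr : 0 < r)
    (hr1 : r < 1) :
    Tendsto (fun γ => C.outageAt P h r γ / γ ^ (-(D * (1 - r)))) atTop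
      (𝓝 ((C.txArea * C.rxArea) ^ D * (D.factorial : ℝ) * ∏ i, C.sigmaSq i)⁻¹) := by
  have hx := tendsto_threshold_mul_rpow (C := C) hr
  have hlim : Tendsto (fun γ => ((2 : ℝ) ^ (r * Real.logb 2 (1 + γ)) - 1) /
      (γ * (C.txArea * C.rxArea))) atTop (𝓝 0) := by
    have h1 := hx.mul (tendsto_rpow_neg_atTop (sub_pos.2 hr1))
    rw [mul_zero] at h1
    refine h1.congr' ?_
    filter_upwards [eventually_gt_atTop 0] with γ hγ
    rw [mul_assoc, ← Real.rpow_add hγ, add_neg_cancel, Real.rpow_zero, mul_one]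
  have hpos : ∀ γ : ℝ, 0 < γ → 0 < r * Real.logb 2 (1 + γ) := fun γ hγ =>
    mul_pos hr (Real.logb_pos one_lt_two (by linarith))
  have h2 := (hh.tendsto_outage_div_pow hD hpos hlim).mul (hx.pow D)
  have h3 : 1 / ((D.factorial : ℝ) * ∏ i, C.sigmaSq i) * (1 / (C.txArea * C.rxArea)) ^ D =
      ((C.txArea * C.rxArea) ^ D * (D.factorial : ℝ) * ∏ i, C.sigmaSq i)⁻¹ := by
    rw [one_div_pow, one_div_mul_one_div, one_div]
    ring_nf
  rw [h3] at h2
  refine h2.congr' ?_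
  filter_upwards [eventually_gt_atTop 0] with γ hγ
  have hA := mul_pos C.txArea_pos C.rxArea_pos
  have hx0 : ((2 : ℝ) ^ (r * Real.logb 2 (1 + γ)) - 1) / (γ * (C.txArea * C.rxArea)) ≠ 0 :=
    (div_pos (sub_pos.2 (Real.one_lt_rpow one_lt_two (hpos γ hγ))) (mul_pos hγ hA)).ne'
  rw [outageAt, mul_pow, div_mul_eq_mul_div, mul_left_comm, mul_div_cancel_left₀ _ (pow_ne_zero _ hx0),
    Real.rpow_neg hγ.le, div_inv_eq_mul, mul_comm (D : ℝ), Real.rpow_mul hγ.le, Real.rpow_natCast]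

/-- The outage times `γ ^ (D (1 - r))` has a positive limit, so its logarithm stays bounded and
disappears after division by `log γ`. -/
lemma IsRayleigh.isDiversityOrder [IsProbabilityMeasure P] (hD : 0 < D) (hh : C.IsRayleigh P h) {r : ℝ} (hr : 0 < r)
    (hr1 : r < 1) : C.IsDiversityOrder P h r (D * (1 - r)) := by
  have hB : 0 < (C.txArea * C.rxArea) ^ D * (D.factorial : ℝ) * ∏ i, C.sigmaSq i :=
    mul_pos (mul_pos (pow_pos (mul_pos C.txArea_pos C.rxArea_pos) _) (by positivity))
      (Finset.prod_pos fun i _ => C.sigmaSq_pos i)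
  have h1 := hh.tendsto_outageAt hD hr hr1
  have h2 := ((h1.log (inv_pos.2 hB).ne').div_atTop Real.tendsto_log_atTop).const_sub
    (D * (1 - r))
  rw [sub_zero] at h2
  refine Tendsto.congr' ?_ h2
  filter_upwards [eventually_gt_atTop 1, h1.eventually_const_lt (inv_pos.2 hB)] with γ hγ hpos
  have hγ0 : 0 < γ := by linarith
  have hlog : Real.log γ ≠ 0 := (Real.log_pos hγ).ne'
  have hne : C.outageAt P h r γ ≠ 0 := fun h0 => by simp [h0] at hpos
  rw [Real.log_div hne (Real.rpow_pos_of_pos hγ0 _).ne', Real.log_rpow hγ0]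
  field_simp
  ring

lemma IsRayleigh.isArrayGain [IsProbabilityMeasure P] (hD : 0 < D) (hh : C.IsRayleigh P h) {r : ℝ} (hr : 0 < r)
    (hr1 : r < 1) : C.IsArrayGain P h r (D * (1 - r))
      (((C.txArea * C.rxArea) ^ D * (D.factorial : ℝ) * ∏ i, C.sigmaSq i) ^
        (1 / (D * (1 - r)))) := by
  have hB : 0 < (C.txArea * C.rxArea) ^ D * (D.factorial : ℝ) * ∏ i, C.sigmaSq i :=
    mul_pos (mul_pos (pow_pos (mul_pos C.txArea_pos C.rxArea_pos) _) (by positivity))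
      (Finset.prod_pos fun i _ => C.sigmaSq_pos i)
  have hd : (D * (1 - r) : ℝ) ≠ 0 :=
    (mul_pos (by exact_mod_cast hD) (sub_pos.2 hr1)).ne'
  refine ⟨Real.rpow_pos_of_pos hB _, ?_⟩
  rw [← Real.rpow_mul hB.le, mul_neg, one_div_mul_cancel hd, Real.rpow_neg_one]
  exact hh.tendsto_outageAt hD hr hr1

/-! ### Average rate at high signal-to-noise ratio. -/

lemma IsRayleigh.integrable_rate (hh : C.IsRayleigh P h) {γ : ℝ} (hγ : 0 < γ) :
    Integrable (fun ω => C.rate γ (fun i => h i ω)) P := by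
  have hA := mul_pos hγ (mul_pos C.txArea_pos C.rxArea_pos)
  have hlog2 : 0 < Real.log 2 := Real.log_pos one_lt_two
  simp_rw [rate_eq]
  refine Integrable.mono' ((hh.integrable_gain.const_mul (γ * (C.txArea * C.rxArea))).div_const
    (Real.log 2)) ?_ (ae_of_all _ fun ω => ?_)
  · have := hh.aemeasurable_gain
    exact ((Real.measurable_log.comp_aemeasurable
      ((this.const_mul _).const_add 1)).div_const _).aestronglyMeasurable
  · have hS : 0 ≤ γ * (C.txArea * C.rxArea) * ∑ i, ‖h i ω‖ ^ 2 :=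
      mul_nonneg hA.le (Finset.sum_nonneg fun i _ => by positivity)
    rw [Real.norm_of_nonneg (Real.logb_nonneg one_lt_two (by linarith)), Real.logb]
    refine div_le_div_of_nonneg_right ?_ hlog2.le
    have := Real.log_le_sub_one_of_pos (x := 1 + γ * (C.txArea * C.rxArea) * ∑ i, ‖h i ω‖ ^ 2)
      (by linarith)
    linarith

/-- The error is the mean of `log₂ (1 + 1 / (γ A S))`, which decreases to 0 as `γ` grows. -/
lemma IsRayleigh.tendsto_averageRate_sub [IsProbabilityMeasure P] (hD : 0 < D) (hh : C.IsRayleigh P h) :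
    Tendsto (fun γ => C.averageRate P h γ - (Real.logb 2 γ + Real.logb 2 (C.txArea * C.rxArea) +
      ∫ ω, Real.logb 2 (∑ i, ‖h i ω‖ ^ 2) ∂P)) atTop (𝓝 0) := by
  have hA := mul_pos C.txArea_pos C.rxArea_pos
  set A := C.txArea * C.rxArea with hA_def
  have hlogb : Integrable (fun ω => Real.logb 2 (∑ i, ‖h i ω‖ ^ 2)) P :=
    (hh.integrable_log_gain hD).div_const _
  have heq : ∀ γ : ℝ, 0 < γ → (fun ω => C.rate γ (fun i => h i ω) -
      (Real.logb 2 γ + Real.logb 2 A + Real.logb 2 (∑ i, ‖h i ω‖ ^ 2))) =ᵐ[P]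
      fun ω => Real.logb 2 (1 + (γ * A * ∑ i, ‖h i ω‖ ^ 2)⁻¹) := fun γ hγ => by
    filter_upwards [hh.ae_gain_pos hD] with ω hω
    rw [rate_eq, ← hA_def, ← Real.logb_mul hγ.ne' hA.ne', ← Real.logb_mul (by positivity) hω.ne',
      ← Real.logb_div (by positivity) (by positivity)]
    congr 1
    field_simp
    ring
  have hint : ∀ γ : ℝ, 0 < γ →
      Integrable (fun ω => Real.logb 2 (1 + (γ * A * ∑ i, ‖h i ω‖ ^ 2)⁻¹)) P := fun γ hγ =>
    ((hh.integrable_rate hγ).sub ((integrable_const _).add hlogb)).congr (heq γ hγ)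
  have hlim : Tendsto (fun γ => ∫ ω, Real.logb 2 (1 + (γ * A * ∑ i, ‖h i ω‖ ^ 2)⁻¹) ∂P) atTop
      (𝓝 (∫ _, (0 : ℝ) ∂P)) := by
    -- The integrand at `γ = 1` dominates for `γ ≥ 1`. It is integrable as the difference of the
    -- rate and the integrable logarithmic terms.
    refine tendsto_integral_filter_of_dominated_convergence
      (fun ω => Real.logb 2 (1 + (1 * A * ∑ i, ‖h i ω‖ ^ 2)⁻¹)) ?_ ?_ (hint 1 one_pos) ?_
    · filter_upwards [eventually_gt_atTop 0] with γ hγ using (hint γ hγ).aestronglyMeasurable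
    · filter_upwards [eventually_ge_atTop 1] with γ hγ
      filter_upwards [hh.ae_gain_pos hD] with ω hω
      have h1 : 0 < (γ * A * ∑ i, ‖h i ω‖ ^ 2)⁻¹ := by positivity
      rw [Real.norm_of_nonneg (Real.logb_nonneg one_lt_two (by linarith))]
      refine Real.logb_le_logb_of_le one_lt_two (by linarith) ?_
      gcongr
    · filter_upwards [hh.ae_gain_pos hD] with ω hω
      have h1 : Tendsto (fun γ : ℝ => 1 + (γ * A * ∑ i, ‖h i ω‖ ^ 2)⁻¹) atTop (𝓝 (1 + 0)) :=
        ((tendsto_id.atTop_mul_const hA).atTop_mul_const hω).inv_tendsto_atTop.const_add 1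
      rw [add_zero] at h1
      simpa [Real.logb] using (h1.log one_ne_zero).div_const (Real.log 2)
  rw [integral_zero] at hlim
  refine hlim.congr' ?_
  filter_upwards [eventually_gt_atTop 0] with γ hγ
  have hsum : Integrable (fun ω => Real.logb 2 γ + Real.logb 2 A +
      Real.logb 2 (∑ i, ‖h i ω‖ ^ 2)) P := (integrable_const _).add hlogb
  rw [← integral_congr_ae (heq γ hγ), integral_sub (hh.integrable_rate hγ) hsum, integral_add (integrable_const _) hlogb, averageRate]
  simp

end SIMOChannel

end CAPA

end

theorem theorem4 {D : ℕ} (hD : 0 < D) (C : CAPA.SIMOChannel D)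
    {Ω : Type*} [MeasurableSpace Ω] (P : Measure Ω) [IsProbabilityMeasure P]
    (h : Fin D → Ω → ℂ) (hh : C.IsRayleigh P h) :
    (∀ R : ℝ, 0 < R →
      (fun γ : ℝ => C.outage P h γ R) ~[atTop]
        (fun γ : ℝ => (((2 : ℝ) ^ R - 1) / (C.txArea * C.rxArea)) ^ D *
          (1 / ((D.factorial : ℝ) * ∏ i, C.sigmaSq i)) * (1 / γ ^ D))) ∧
    ((∀ γ : ℝ, 0 < γ → Integrable (fun ω => C.rate γ (fun i => h i ω)) P) ∧
      Summable C.digammaTerm ∧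
      Tendsto (fun γ : ℝ => C.averageRate P h γ -
          (Real.logb 2 γ + Real.logb 2 (C.txArea * C.rxArea) +
            C.sigmaSqMin ^ D / (∏ i, C.sigmaSq i) * ∑' q, C.digammaTerm q)) atTop (𝓝 0)) ∧
    (∀ r : ℝ, 0 < r → r < 1 →
      C.IsDiversityOrder P h r (D * (1 - r)) ∧
      C.IsArrayGain P h r (D * (1 - r))
        (((C.txArea * C.rxArea) ^ D * (D.factorial : ℝ) * ∏ i, C.sigmaSq i) ^
          (1 / (D * (1 - r))))) := by
  have hs := hh.hasSum_digammaTerm hD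
  have hc : C.sigmaSqMin ^ D / (∏ i, C.sigmaSq i) ≠ 0 :=
    (div_pos (pow_pos (C.sigmaSqMin_pos hD) _)
      (Finset.prod_pos fun i _ => C.sigmaSq_pos i)).ne'
  -- The mixture constant is nonzero and can be cancelled; for real series `Summable` amounts to
  -- absolute convergence.
  refine ⟨fun R hR => hh.outage_isEquivalent hD hR, ⟨fun γ hγ => hh.integrable_rate hγ,
    (summable_mul_left_iff hc).1 hs.summable, ?_⟩,
    fun r hr hr1 => ⟨hh.isDiversityOrder hD hr hr1, hh.isArrayGain hD hr hr1⟩⟩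
  rw [← tsum_mul_left, hs.tsum_eq]
  exact hh.tendsto_averageRate_sub hD
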